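/- Let $K$ be a field. For a finite separable extension $L/L_0$ of fields containing $K$, and a field $E_0$ with $K\subseteq E_0\subseteq L_0$, say that $L/L_0$ is defined over $E_0$ if there is a field $E$ with $E_0\subseteq E\subseteq L$, $[E:E_0]=[L:L_0]$ and $L=EL_0$; let $\mathrm{ed}_K(L/L_0)$ be the minimum of $\operatorname{trdeg}_K E_0$ over all $E_0$ over which $L/L_0$ is defined. For a finite group $G$, the essential dimension $\mathrm{ed}_K(G)$ is $\mathrm{ed}_K(K(V)/K(V)^G)$, where $V$ is any faithful finite-dimensional representation of $G$ over $K$ and $K(V)$ is the function field of the affine space $V$ (the rational function field over $K$ on a basis of $V^*$, with the induced action of $G$). (1) If $\operatorname{char}K=2$, then $\mathrm{ed}_K(A_8)\le 3$; that is, $\mathrm{ed}_K(K(V)/K(V)^{A_8})\le 3$ for every faithful finite-dimensional representation $V$ of $A_8$ over $K$. (2) If $K$ contains $\mathbb{F}_4$, then $\mathrm{ed}_K(A_5)=1$; that is, $\mathrm{ed}_K(K(V)/K(V)^{A_5})=1$ for every faithful finite-dimensional representation $V$ of $A_5$ over $K$. -/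

import Mathlib

noncomputable section

namespace EssDim

section Extension

variable {K L : Type*} [Field K] [Field L] [Algebra K L]

/-- For a finite separable extension `L / L₀` of fields containing `K`: the extension `L / L₀` is
defined over `E₀`, where `K ⊆ E₀ ⊆ L₀`, if there is a field `E` with `L ⊇ E ⊇ E₀`,
`[E : E₀] = [L : L₀]` and `L = E L₀`.  (For `E₀ ≤ E`, `relfinrank E₀ E` is the degree `[E : E₀]`;
it is `0` when the degree is infinite, which cannot happen here as `[L : L₀]` is positive.) -/
def IsDefinedOver (L₀ E₀ : IntermediateField K L) : Prop :=
  E₀ ≤ L₀ ∧ ∃ E : IntermediateField K L,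
    E₀ ≤ E ∧ IntermediateField.relfinrank E₀ E = Module.finrank L₀ L ∧ E ⊔ L₀ = ⊤

/-- The essential dimension `ed_K(L / L₀)` of a finite separable extension `L / L₀` of fields
containing `K`: the minimum of `trdeg_K E₀` over all `E₀` over which `L / L₀` is defined.
The set is nonempty (take `E₀ = L₀` and `E = L`), so the infimum of cardinals is a minimum. -/
def edExt (L₀ : IntermediateField K L) : Cardinal :=
  sInf {c : Cardinal | ∃ E₀ : IntermediateField K L,
    IsDefinedOver L₀ E₀ ∧ Algebra.trdeg K E₀ = c}

end Extension

section Representation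

variable {K G V : Type*} [Field K] [Group G] [AddCommGroup V] [Module K V]

variable (K V) in
/-- The ring `K[V]` of polynomial functions on the affine space `V`: the symmetric algebra of the
dual space.  If `x₁, …, xₙ` is a basis of the dual space, it is `K[x₁, …, xₙ]`. -/
abbrev CoordRing : Type _ := SymmetricAlgebra K (Module.Dual K V)

variable (K V) in
/-- The function field `K(V)` of the affine space `V`, that is, `K(x₁, …, xₙ)`. -/
abbrev FunField : Type _ := FractionRing (CoordRing K V)

/-- `G` acts on `K[V]` by algebra endomorphisms extending its action on the dual space,
`(g • f)(v) = f (g⁻¹ v)` for a linear form `f`. -/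
def coordRingEnd (ρ : Representation K G V) : G →* (CoordRing K V →ₐ[K] CoordRing K V) where
  toFun g := SymmetricAlgebra.lift (SymmetricAlgebra.ι K (Module.Dual K V) ∘ₗ ρ.dual g)
  map_one' := by
    apply SymmetricAlgebra.algHom_ext
    ext f
    simp only [map_one, SymmetricAlgebra.lift_comp_ι]
    rfl
  map_mul' g h := by
    apply SymmetricAlgebra.algHom_ext
    apply LinearMap.ext
    intro f
    change _ = SymmetricAlgebra.lift _ (SymmetricAlgebra.lift _ (SymmetricAlgebra.ι K _ f))
    simp only [SymmetricAlgebra.lift_comp_ι, map_mul, LinearMap.comp_apply, Module.End.mul_apply,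
      SymmetricAlgebra.lift_ι_apply]

/-- The action of `G` on `K[V]` by `K`-algebra automorphisms. -/
def coordRingAut (ρ : Representation K G V) : G →* (CoordRing K V ≃ₐ[K] CoordRing K V) :=
  (AlgEquiv.algHomUnitsEquiv K (CoordRing K V)).toMonoidHom.comp (coordRingEnd ρ).toHomUnits

/-- The action of `G` on `K(V)` by `K`-automorphisms, extending the action on `K[V]`. -/
def funFieldAut (ρ : Representation K G V) : G →* (FunField K V ≃ₐ[K] FunField K V) :=
  (IsFractionRing.fieldEquivOfAlgEquivHom K (FunField K V)).comp (coordRingAut ρ)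

/-- The fixed field `K(V)^G`. -/
def invField (ρ : Representation K G V) : IntermediateField K (FunField K V) :=
  IntermediateField.fixedField (funFieldAut ρ).range

/-- `ed_K(K(V) / K(V)^G)`.  When `ρ` is a faithful finite-dimensional representation of the finite
group `G`, this is by definition the essential dimension `ed_K(G)`. -/
def edRep (ρ : Representation K G V) : Cardinal :=
  edExt (invField ρ)

end Representation

end EssDim

end

/-! Let `G` act faithfully on `L` over `K`. A `G`-stable subfield `E` with faithful action gives
Galois extensions `E/E^G` and `L/L^G` with the same group, so `L/L^G` is defined over `E^G` and the
essential dimension is at most the transcendence degree of `E`. Such an `E` comes from a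
representation `W` of dimension `n + 1`. The normal basis theorem embeds `W` equivariantly in `L`,
and ratios of elements of the image generate a stable field with `n` generators
(`edExt_le_of_representation`). Scalars act trivially on ratios, but for simple `G` one nonscalar
element makes the action faithful. The bounds 3 and 1 come from the exceptional maps of `A₈` to
`GL₄(𝔽₂)` and of `A₅` to `SL₂(𝔽₄)`. The lower bound for `A₅` holds because `K` is algebraically
closed in `K(V)`: over a base of transcendence degree 0 only a trivial extension could be defined.
-/

namespace EssDim

section GaloisAction

variable {G F M : Type*} [Group G] [Field F] [Field M] [Algebra F M]

/-- The action of `G` on `M` defined by a homomorphism to the `F`-algebra endomorphisms of `M`. -/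
abbrev endAction (Ψ : G →* (M →ₐ[F] M)) : MulSemiringAction G M where
  smul g x := Ψ g x
  one_smul x := by change Ψ 1 x = x; simp
  mul_smul g h x := by change Ψ (g * h) x = Ψ g (Ψ h x); simp
  smul_zero g := map_zero (Ψ g)
  smul_add g := map_add (Ψ g)
  smul_one g := map_one (Ψ g)
  smul_mul g := map_mul (Ψ g)

theorem isGaloisGroup_of_invariants (Ψ : G →* (M →ₐ[F] M)) (hinj : Function.Injective Ψ)
    (hinv : ∀ x : M, (∀ g, Ψ g x = x) → ∃ y, algebraMap F M y = x) :
    let := endAction Ψ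
    IsGaloisGroup G F M :=
  let := endAction Ψ
  { faithful := ⟨fun h => hinj (AlgHom.ext h)⟩
    commutes := ⟨fun g a x => map_smul (Ψ g) a x⟩
    isInvariant := ⟨fun x hx => hinv x hx⟩ }

end GaloisAction

/-! ### Stable subfields bound the essential dimension. -/

section Compression

variable {G K L : Type*} [Group G] [Finite G] [Field K] [Field L] [Algebra K L]
  (Φ : G →* (L ≃ₐ[K] L))

/-- The action of `G` on `L` is linear over the fixed field. -/
def fixedFieldEnd : G →* (L →ₐ[IntermediateField.fixedField Φ.range] L) where
  toFun g := { (Φ g : L →+* L) with commutes' := fun x => x.2 ⟨Φ g, g, rfl⟩ }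
  map_one' := by ext x; exact congr($(map_one Φ) x)
  map_mul' g h := by ext x; exact congr($(map_mul Φ g h) x)

omit [Finite G] in
theorem mem_fixedField_range {x : L} :
    x ∈ IntermediateField.fixedField Φ.range ↔ ∀ g, Φ g x = x := by
  simp [IntermediateField.mem_fixedField_iff]

omit [Finite G] in
variable {Φ} in
theorem isGaloisGroup_fixedField (hΦ : Function.Injective Φ) :
    let := endAction (fixedFieldEnd Φ)
    IsGaloisGroup G (IntermediateField.fixedField Φ.range) L :=
  isGaloisGroup_of_invariants (fixedFieldEnd Φ)
    (fun _ _ h => hΦ (AlgEquiv.ext fun x => congr($h x)))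
    (fun x hx => ⟨⟨x, (mem_fixedField_range Φ).2 hx⟩, rfl⟩)

omit [Finite G] in
variable {Φ} in
theorem finrank_fixedField (hΦ : Function.Injective Φ) :
    Module.finrank (IntermediateField.fixedField Φ.range) L = Nat.card G :=
  let := endAction (fixedFieldEnd Φ)
  have := isGaloisGroup_fixedField hΦ
  (IsGaloisGroup.card_eq_finrank G _ L).symm

variable {Φ} in
theorem exists_linearIndependent_orbit (hΦ : Function.Injective Φ) :
    ∃ θ : L, LinearIndependent K fun g => Φ g θ := by
  let L₀ := IntermediateField.fixedField Φ.range
  let := endAction (fixedFieldEnd Φ)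
  have := isGaloisGroup_fixedField hΦ
  have : FiniteDimensional L₀ L := IsGaloisGroup.finiteDimensional G L₀ L
  obtain ⟨θ, hθ⟩ := exists_linearIndependent_algEquiv_apply L₀ L
  refine ⟨θ, ?_⟩
  have h := (hθ.comp (MulSemiringAction.toAlgAut G L₀ L) fun g h hgh =>
    hΦ (AlgEquiv.ext fun x => congr($hgh x)))
  exact h.restrict_scalars' K

/-- The restriction of the action of `G` on `L` to a stable subfield `E`, as an action that is
linear over a subfield of the invariants. -/
def stableEnd {E₀ E : IntermediateField K L} (hE₀ : E₀ ≤ E)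
    (hfix : ∀ x ∈ E₀, ∀ g, Φ g x = x) (hE : ∀ g, ∀ x ∈ E, Φ g x ∈ E) :
    G →* (IntermediateField.extendScalars hE₀ →ₐ[E₀] IntermediateField.extendScalars hE₀) where
  toFun g :=
    { toFun := fun x => ⟨Φ g x.1, hE g x.1 x.2⟩
      map_one' := Subtype.ext (map_one (Φ g))
      map_mul' := fun x y => Subtype.ext (map_mul (Φ g) x.1 y.1)
      map_zero' := Subtype.ext (map_zero (Φ g))
      map_add' := fun x y => Subtype.ext (map_add (Φ g) x.1 y.1)
      commutes' := fun x => Subtype.ext (hfix x.1 x.2 g) }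
  map_one' := by ext x; exact congr($(map_one Φ) x.1)
  map_mul' g h := by ext x; exact congr($(map_mul Φ g h) x.1)

-- By Artin's theorem both degrees equal the order of `G`. An element fixing the compositum of `E`
-- and the invariant field fixes `E`, hence is trivial, so by the Galois correspondence the
-- compositum is `L`.
variable {Φ} in
theorem isDefinedOver_of_stable (hΦ : Function.Injective Φ) (E : IntermediateField K L)
    (hE : ∀ g, ∀ x ∈ E, Φ g x ∈ E) (hfaith : ∀ g, (∀ x ∈ E, Φ g x = x) → g = 1) :
    IsDefinedOver (IntermediateField.fixedField Φ.range)
      (E ⊓ IntermediateField.fixedField Φ.range) := by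
  set L₀ := IntermediateField.fixedField Φ.range
  refine ⟨inf_le_right, E, inf_le_left, ?_, ?_⟩
  · have hfix : ∀ x ∈ E ⊓ L₀, ∀ g, Φ g x = x := fun x hx => (mem_fixedField_range Φ).1 hx.2
    rw [IntermediateField.relfinrank_eq_finrank_of_le inf_le_left, finrank_fixedField hΦ]
    let := endAction (stableEnd Φ inf_le_left hfix hE)
    have := isGaloisGroup_of_invariants (stableEnd Φ inf_le_left hfix hE)
      (by
        rw [injective_iff_map_eq_one]
        intro g hg
        exact hfaith g fun x hx => congr(($hg ⟨x, hx⟩).1))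
      (fun x hx => ⟨⟨x.1, x.2, (mem_fixedField_range Φ).2 fun g => congr(($(hx g)).1)⟩, rfl⟩)
    exact (IsGaloisGroup.card_eq_finrank G _ _).symm
  · let := endAction (fixedFieldEnd Φ)
    have := isGaloisGroup_fixedField hΦ
    have hle : L₀ ≤ E ⊔ L₀ := le_sup_right
    have hbot : fixingSubgroup G ((IntermediateField.extendScalars hle : Set L)) = ⊥ := by
      rw [eq_bot_iff]
      intro g hg
      exact hfaith g fun x hx => hg ⟨x, (le_sup_left : E ≤ E ⊔ L₀) hx⟩
    have hcard := IsGaloisGroup.card_fixingSubgroup_eq_finrank G L₀ L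
      (IntermediateField.extendScalars hle)
    rw [hbot, Subgroup.card_bot] at hcard
    have htop := IntermediateField.finrank_eq_one_iff_eq_top.1 hcard.symm
    rw [eq_top_iff]
    intro x _
    have : x ∈ IntermediateField.extendScalars hle := htop ▸ IntermediateField.mem_top
    exact this

omit [Finite G] in
theorem trdeg_adjoin_range_le {n : ℕ} (s : Fin n → L) :
    Algebra.trdeg K (IntermediateField.adjoin K (Set.range s)) ≤ n := by
  let A := IntermediateField.adjoin K (Set.range s)
  let t : Fin n → A := fun i => ⟨s i, IntermediateField.subset_adjoin K _ ⟨i, rfl⟩⟩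
  have hmap : (Algebra.adjoin K (Set.range t)).map A.val = Algebra.adjoin K (Set.range s) := by
    rw [AlgHom.map_adjoin, ← Set.range_comp]
    rfl
  have halg : Algebra.IsAlgebraic (Algebra.adjoin K (Set.range t)) A := by
    refine ⟨fun x => ?_⟩
    obtain ⟨a, ha, b, hb, hx⟩ := IntermediateField.mem_adjoin_iff_div.1 x.2
    rw [← hmap] at ha hb
    obtain ⟨a, ha, rfl⟩ := ha
    obtain ⟨b, hb, rfl⟩ := hb
    have hx' : x = a * b⁻¹ := Subtype.ext (hx.trans (div_eq_mul_inv _ _))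
    rw [hx']
    exact (isAlgebraic_algebraMap (⟨a, ha⟩ : Algebra.adjoin K (Set.range t))).mul
      (isAlgebraic_algebraMap (⟨b, hb⟩ : Algebra.adjoin K (Set.range t))).inv
  refine (Algebra.IsAlgebraic.trdeg_le_cardinalMk K (Set.range t)).trans ?_
  simpa using Cardinal.mk_range_le_lift (f := t)

variable {Φ} in
theorem edExt_le_of_stable (hΦ : Function.Injective Φ) (E : IntermediateField K L)
    (hE : ∀ g, ∀ x ∈ E, Φ g x ∈ E) (hfaith : ∀ g, (∀ x ∈ E, Φ g x = x) → g = 1) :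
    edExt (IntermediateField.fixedField Φ.range) ≤ Algebra.trdeg K E := by
  have hmem : Algebra.trdeg K ↥(E ⊓ IntermediateField.fixedField Φ.range) ∈
      {c : Cardinal | ∃ E₀ : IntermediateField K L,
        IsDefinedOver (IntermediateField.fixedField Φ.range) E₀ ∧ Algebra.trdeg K E₀ = c} :=
    ⟨_, isDefinedOver_of_stable hΦ E hE hfaith, rfl⟩
  exact (csInf_le' hmem).trans
    (trdeg_le_of_injective (IntermediateField.inclusion inf_le_left)
      (IntermediateField.inclusion_injective _))

end Compression

/-! ### Stable subfields from representations. -/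

section LinearCompression

variable {G K L : Type*} [Group G] [Finite G] [Field K] [Field L] [Algebra K L]
  {Φ : G →* (L ≃ₐ[K] L)} {W : Type*} [AddCommGroup W] [Module K W]

/-- A representation with a linear form whose orbit separates points embeds equivariantly in any
field on which the group acts faithfully. -/
theorem exists_equivariant_injective (hΦ : Function.Injective Φ) (R : Representation K G W)
    (φ : Module.Dual K W) (hφ : ∀ v, (∀ g, φ (R g v) = 0) → v = 0) :
    ∃ f : W →ₗ[K] L, Function.Injective f ∧ ∀ g v, Φ g (f v) = f (R g v) := by
  have := Fintype.ofFinite G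
  obtain ⟨θ, hθ⟩ := exists_linearIndependent_orbit hΦ
  -- The orbit of `φ` maps `W` to the regular representation, which the independent conjugates of
  -- `θ` realize inside `L`.
  let f : W →ₗ[K] L := ∑ g : G, (φ ∘ₗ R g⁻¹).smulRight (Φ g θ)
  have hf : ∀ v, f v = ∑ g : G, φ (R g⁻¹ v) • Φ g θ := fun v => by simp [f]
  refine ⟨f, ?_, fun g v => ?_⟩
  · rw [injective_iff_map_eq_zero]
    intro v hv
    rw [hf] at hv
    refine hφ v fun g => ?_
    simpa using Fintype.linearIndependent_iff.1 hθ _ hv g⁻¹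
  · rw [hf, hf, map_sum]
    refine Fintype.sum_equiv (Equiv.mulLeft g) _ _ fun h => ?_
    have h1 : R (g * h)⁻¹ (R g v) = R h⁻¹ v := by
      rw [← Module.End.mul_apply, ← map_mul]
      congr 2
      group
    simp only [Equiv.coe_mulLeft, h1, map_smul, map_mul]
    rfl

/-- If a simple group `G` has a representation of dimension `n + 1` that embeds equivariantly in
`L`, in which some `g ≠ 1` fixes a nonzero vector, then `L` has a faithful `G`-stable subfield
generated by `n` elements. -/
theorem edExt_le_of_representation [IsSimpleGroup G] (hΦ : Function.Injective Φ) {n : ℕ}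
    (R : Representation K G (Fin (n + 1) → K)) (φ : Module.Dual K (Fin (n + 1) → K))
    (hφ : ∀ v, (∀ g, φ (R g v) = 0) → v = 0) {g₁ : G} {v₁ : Fin (n + 1) → K}
    (hg₁ : R g₁ ≠ 1) (hv₁ : v₁ ≠ 0) (hfix : R g₁ v₁ = v₁) :
    edExt (IntermediateField.fixedField Φ.range) ≤ n := by
  obtain ⟨f, hf, hequiv⟩ := exists_equivariant_injective hΦ R φ hφ
  have hf0 : ∀ {v}, v ≠ 0 → f v ≠ 0 := fun hv h => hv (hf (h.trans (map_zero f).symm))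
  let b : Fin (n + 1) → (Fin (n + 1) → K) := fun i => Pi.single i 1
  have hb0 : b 0 ≠ 0 := fun h => by simpa [b] using congr($h 0)
  -- All ratios of elements of the image of `W` lie in this field; dividing by one fixed basis
  -- vector leaves only `n` generators.
  let E := IntermediateField.adjoin K (Set.range fun i : Fin n => f (b i.succ) / f (b 0))
  have hmem : ∀ v, f v / f (b 0) ∈ E := by
    intro v
    have hv : v = ∑ i, v i • b i := by
      ext j
      simp [b, Finset.sum_apply, Pi.single_apply]
    rw [hv, map_sum, Finset.sum_div]
    refine sum_mem fun i _ => ?_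
    rw [map_smul, smul_div_assoc]
    refine E.smul_mem ?_
    induction i using Fin.cases with
    | zero => rw [div_self (hf0 hb0)]; exact one_mem E
    | succ i => exact IntermediateField.subset_adjoin K _ ⟨i, rfl⟩
  have hmem' : ∀ v w, f v / f w ∈ E := fun v w => by
    have := div_mem (hmem v) (hmem w)
    rwa [div_div_div_cancel_right₀ (hf0 hb0)] at this
  have hstable : ∀ g, ∀ x ∈ E, Φ g x ∈ E := by
    intro g
    change E ≤ E.comap (Φ g : L →ₐ[K] L)
    rw [IntermediateField.adjoin_le_iff]
    rintro _ ⟨i, rfl⟩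
    change Φ g _ ∈ E
    simp only [map_div₀, hequiv]
    exact hmem' _ _
  let N : Subgroup G :=
    { carrier := {g | ∀ x ∈ E, Φ g x = x}
      one_mem' := by simp
      mul_mem' := fun {g h} hg hh x hx => by
        rw [map_mul, AlgEquiv.mul_apply, hh x hx, hg x hx]
      inv_mem' := fun {g} hg x hx => by
        rw [map_inv]
        exact (Φ g).injective ((AlgEquiv.apply_symm_apply _ _).trans (hg x hx).symm) }
  have hN : N.Normal := ⟨fun g hg h x hx => by
    have := hg _ (hstable h⁻¹ x hx)
    rw [map_mul, map_mul, AlgEquiv.mul_apply, AlgEquiv.mul_apply, this, ← AlgEquiv.mul_apply,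
      ← map_mul, mul_inv_cancel, map_one, AlgEquiv.one_apply]⟩
  refine (edExt_le_of_stable hΦ E hstable fun g hg => ?_).trans (trdeg_adjoin_range_le _)
  rcases hN.eq_bot_or_eq_top with h | h
  · exact (Subgroup.mem_bot (G := G)).1 (h ▸ (show g ∈ N from hg))
  · refine absurd (LinearMap.ext fun v => ?_) hg₁
    have h1 : g₁ ∈ N := h ▸ Subgroup.mem_top g₁
    -- If all of `G` acted trivially on `E`, then `g₁`, fixing `f v₁` and every ratio `f v / f v₁`,
    -- would fix every `f v`.
    have h2 := h1 _ (hmem' v v₁)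
    rw [map_div₀, hequiv, hequiv, hfix, div_left_inj' (hf0 hv₁)] at h2
    exact hf h2

end LinearCompression

/-! ### The lower bound. -/

section LowerBound

variable {K L : Type*} [Field K] [Field L] [Algebra K L]

theorem one_le_edExt (halg : ∀ x : L, IsAlgebraic K x → x ∈ (⊥ : IntermediateField K L))
    (L₀ : IntermediateField K L) (h1 : 1 < Module.finrank L₀ L) : 1 ≤ edExt L₀ := by
  refine le_csInf ⟨_, L₀, ⟨le_rfl, ⊤, le_top, ?_, top_sup_eq _⟩, rfl⟩ ?_
  · exact IntermediateField.relfinrank_top_right _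
  rintro c ⟨E₀, ⟨-, E, -, hE, -⟩, rfl⟩
  rw [Cardinal.one_le_iff_ne_zero]
  intro h0
  have hE₀ : Algebra.IsAlgebraic K E₀ := trdeg_eq_zero_iff.1 h0
  have hbot : E₀ = ⊥ := eq_bot_iff.2 fun x hx =>
    halg x (IntermediateField.isAlgebraic_iff.1 (Algebra.IsAlgebraic.isAlgebraic (R := K) (⟨x, hx⟩ : E₀)))
  rw [hbot, IntermediateField.relfinrank_bot_left] at hE
  -- The degree is greater than 1, so it is not the default value 0 of an infinite degree.
  have : FiniteDimensional K E := Module.finite_of_finrank_pos (by omega)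
  have hbot' : E = ⊥ := eq_bot_iff.2 fun x hx =>
    halg x (IntermediateField.isAlgebraic_iff.1
      (Algebra.IsAlgebraic.isAlgebraic (R := K) (⟨x, hx⟩ : E)))
  rw [hbot', IntermediateField.finrank_bot] at hE
  omega

end LowerBound

/-! ### The function field of an affine space. -/

section FunctionField

variable {K V : Type*} [Field K] [AddCommGroup V] [Module K V]

/-- The base field is algebraically closed in the function field of an affine space. -/
theorem mem_bot_of_isAlgebraic {L : Type*} [Field L] [Algebra K L] [Algebra (CoordRing K V) L]
    [IsFractionRing (CoordRing K V) L] [IsScalarTower K (CoordRing K V) L]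
    (x : L) (hx : IsAlgebraic K x) : x ∈ (⊥ : IntermediateField K L) := by
  let b := Module.Free.chooseBasis K (Module.Dual K V)
  let e := SymmetricAlgebra.equivMvPolynomial b
  have : UniqueFactorizationMonoid (CoordRing K V) :=
    e.symm.toMulEquiv.uniqueFactorizationMonoid inferInstance
  rcases eq_or_ne x 0 with rfl | hx0
  · exact zero_mem _
  -- A factorial ring is integrally closed, so `x` and its inverse are both polynomials; a unit
  -- polynomial is constant.
  have hint : ∀ y : L, IsAlgebraic K y → ∃ p, algebraMap (CoordRing K V) _ p = y :=
    fun y hy => IsIntegrallyClosed.isIntegral_iff.1 hy.isIntegral.tower_top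
  obtain ⟨p, rfl⟩ := hint x hx
  obtain ⟨q, hq⟩ := hint _ hx.inv
  have hpq : p * q = 1 := by
    apply IsFractionRing.injective (CoordRing K V) L
    rw [map_mul, hq, mul_inv_cancel₀ hx0, map_one]
  have hunit : IsUnit (e p) := (IsUnit.of_mul_eq_one q hpq).map e
  obtain ⟨c, -, hc⟩ := MvPolynomial.isUnit_iff_eq_C_of_isReduced.1 hunit
  have hp : p = algebraMap K _ c := by
    apply e.injective
    rw [hc, AlgEquiv.commutes, MvPolynomial.algebraMap_eq]
  rw [IntermediateField.mem_bot, hp, ← IsScalarTower.algebraMap_apply]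
  exact ⟨c, rfl⟩

variable {G : Type*} [Group G] {ρ : Representation K G V}

theorem coordRingAut_ι (g : G) (f : Module.Dual K V) :
    coordRingAut ρ g (SymmetricAlgebra.ι K _ f) = SymmetricAlgebra.ι K _ (ρ.dual g f) :=
  SymmetricAlgebra.lift_ι_apply _ _

theorem funFieldAut_injective (hρ : Function.Injective ρ) :
    Function.Injective (funFieldAut ρ) := by
  have hinj : Function.Injective (coordRingAut ρ) := by
    rw [injective_iff_map_eq_one]
    intro g hg
    rw [← inv_eq_one, ← map_eq_one_iff ρ hρ]
    ext v
    rw [← sub_eq_zero, ← Module.forall_dual_apply_eq_zero_iff K]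
    intro f
    have h := coordRingAut_ι (ρ := ρ) g f
    rw [hg, AlgEquiv.one_apply] at h
    have h' := congr(SymmetricAlgebra.lift (Module.Dual.eval K V v) $h)
    rw [SymmetricAlgebra.lift_ι_apply, SymmetricAlgebra.lift_ι_apply] at h'
    rw [map_sub, sub_eq_zero]
    exact h'.symm
  exact (IsFractionRing.fieldEquivOfAlgEquivHom_injective K (CoordRing K V) K
    (FunField K V)).comp hinj

theorem one_le_edRep [Finite G] [Nontrivial G] (hρ : Function.Injective ρ) : 1 ≤ edRep ρ := by
  have hrank : Module.finrank (invField ρ) (FunField K V) = Nat.card G :=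
    finrank_fixedField (funFieldAut_injective hρ)
  exact one_le_edExt (mem_bot_of_isAlgebraic (V := V)) (invField ρ)
    (hrank ▸ Finite.one_lt_card)

end FunctionField

/-! ### Homomorphisms from alternating groups, through their graphs. -/

section Graph

variable {α H : Type*} [Fintype α] [DecidableEq α] [Group H]

open Equiv Equiv.Perm in
/-- The alternating group is generated by products of two transpositions moving a given point `a`,
the first of which is fixed. -/
theorem alternatingGroup_eq_top_of_swap_mul_swap {a b : α} (hab : a ≠ b)
    (S : Subgroup (alternatingGroup α))
    (hS : ∀ i, i ≠ a → i ≠ b → ∃ g ∈ S, (g : Perm α) = swap a b * swap a i) : S = ⊤ := by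
  let T : Subgroup (Perm α) := S.map (alternatingGroup α).subtype
  have hT : ∀ i, i ≠ a → swap a b * swap a i ∈ T := by
    intro i hi
    rcases eq_or_ne i b with rfl | hib
    · rw [swap_mul_self]
      exact one_mem T
    · obtain ⟨g, hg, h⟩ := hS i hi hib
      exact ⟨g, hg, h⟩
  -- The union of `T` and its coset by `swap a b` is stable under left multiplication by
  -- transpositions, hence is everything; the sign then tells the two apart.
  let P : Perm α → Prop := fun g => g ∈ T ∨ swap a b * g ∈ T
  have hstar : ∀ i, i ≠ a → ∀ g, P g → P (swap a i * g) := by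
    rintro i hi g (hg | hg)
    · right
      rw [← mul_assoc]
      exact mul_mem (hT i hi) hg
    · left
      have := mul_mem (inv_mem (hT i hi)) hg
      rwa [mul_inv_rev, swap_inv, swap_inv, mul_assoc, swap_mul_self_mul] at this
  have hswap : ∀ i j, i ≠ j → ∀ g, P g → P (swap i j * g) := by
    intro i j hij g hg
    rcases eq_or_ne i a with rfl | hi
    · exact hstar j hij.symm g hg
    rcases eq_or_ne j a with rfl | hj
    · rw [swap_comm]
      exact hstar i hi g hg
    have : swap i j = swap a i * swap a j * swap a i := by
      rw [swap_comm a j, swap_mul_swap_mul_swap hj hij.symm]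
    rw [this, mul_assoc, mul_assoc]
    exact hstar i hi _ (hstar j hj _ (hstar i hi g hg))
  have hP : ∀ g, P g := fun g => swap_induction_on g (Or.inl (one_mem T))
    fun f x y hxy hf => hswap x y hxy f hf
  rw [eq_top_iff]
  rintro ⟨g, hg⟩ -
  rcases hP g with ⟨h, hh, he⟩ | ⟨h, hh, he⟩
  · exact (Subtype.ext he : h = ⟨g, hg⟩) ▸ hh
  · have h1 : sign (h : Perm α) = 1 := mem_alternatingGroup.1 h.2
    have h2 : (h : Perm α) = swap a b * g := he
    rw [h2, Equiv.Perm.sign_mul, sign_swap hab, mem_alternatingGroup.1 hg] at h1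
    exact absurd h1 (by decide)

open Equiv in
/-- A homomorphism from an alternating group is determined by its graph, which has to be functional
and to project onto a set of generators. -/
theorem exists_hom_of_graph {a b : α} (hab : a ≠ b) (Γ : Subgroup (alternatingGroup α × H))
    (huniq : ∀ h, ((1 : alternatingGroup α), h) ∈ Γ → h = 1)
    (hgen : ∀ i, i ≠ a → i ≠ b → ∃ x ∈ Γ, (x.1 : Perm α) = swap a b * swap a i) :
    ∃ f : alternatingGroup α →* H, ∀ g h, (g, h) ∈ Γ → f g = h := by
  have hbij : Function.Bijective (Prod.fst ∘ Γ.subtype) := by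
    constructor
    · have : Function.Injective ((MonoidHom.fst _ _).comp Γ.subtype) := by
        rw [injective_iff_map_eq_one]
        rintro ⟨⟨g, h⟩, hgh⟩ (rfl : g = 1)
        obtain rfl := huniq h hgh
        rfl
      exact this
    · have htop : Γ.map (MonoidHom.fst _ _) = ⊤ := by
        refine alternatingGroup_eq_top_of_swap_mul_swap hab _ fun i hi hi' => ?_
        obtain ⟨x, hx, h⟩ := hgen i hi hi'
        exact ⟨x.1, ⟨x, hx, rfl⟩, h⟩
      intro g
      obtain ⟨x, hx, h⟩ := (htop ▸ Subgroup.mem_top g : g ∈ Γ.map (MonoidHom.fst _ _))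
      exact ⟨⟨x, hx⟩, h⟩
  obtain ⟨f, hf⟩ := Subgroup.exists_eq_graph hbij
  refine ⟨f, fun g h hgh => ?_⟩
  rw [hf] at hgh
  exact MonoidHom.mem_graph.1 hgh

end Graph

open Equiv Matrix

/-- The product of two transpositions moving `0`. -/
def swapMulSwap {n : ℕ} (i : Fin (n + 2)) (h0 : i ≠ 0) : alternatingGroup (Fin (n + 2)) :=
  ⟨swap 0 1 * swap 0 i, Perm.mul_mem_alternatingGroup_of_isSwap ⟨0, 1, by simp, rfl⟩
    ⟨0, i, h0.symm, rfl⟩⟩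

/-! ### `A₈` and `GL₄(𝔽₂)`. -/

section FourDimensional

/-- Eight alternating forms on `𝔽₂⁴` whose pairwise sums are nondegenerate; these sums are all the
`28` nondegenerate alternating forms. -/
def altForm : Fin 8 → Matrix (Fin 4) (Fin 4) (ZMod 2) :=
  ![!![0, 0, 0, 0; 0, 0, 0, 0; 0, 0, 0, 0; 0, 0, 0, 0],
    !![0, 0, 0, 1; 0, 0, 1, 0; 0, 1, 0, 0; 1, 0, 0, 0],
    !![0, 0, 1, 0; 0, 0, 1, 1; 1, 1, 0, 0; 0, 1, 0, 0],
    !![0, 0, 1, 1; 0, 0, 0, 1; 1, 0, 0, 1; 1, 1, 1, 0],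
    !![0, 1, 0, 0; 1, 0, 1, 1; 0, 1, 0, 1; 0, 1, 1, 0],
    !![0, 1, 0, 1; 1, 0, 0, 0; 0, 0, 0, 1; 1, 0, 1, 0],
    !![0, 1, 1, 0; 1, 0, 1, 0; 1, 1, 0, 1; 0, 0, 1, 0],
    !![0, 1, 1, 1; 1, 0, 0, 1; 1, 0, 0, 0; 1, 1, 0, 0]]

/-- The graph of the exceptional isomorphism of `A₈` with `GL₄(𝔽₂)`. -/
def graphA₈ : Subgroup (alternatingGroup (Fin 8) × GL (Fin 4) (ZMod 2)) where
  -- Sending `{i, j}` to the sum of the two forms identifies even subsets of eight points, modulo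
  -- complements, with alternating forms. Only sums are used, as the forms themselves are permuted
  -- up to a common translation.
  carrier := {x | ∀ i j, (x.2.1)ᵀ * (altForm (x.1.1 i) + altForm (x.1.1 j)) * x.2.1 =
    altForm i + altForm j}
  one_mem' i j := by simp
  mul_mem' {x y} hx hy i j := by
    have h := hx (y.1.1 i) (y.1.1 j)
    change (x.2.1 * y.2.1)ᵀ * (altForm (x.1.1 (y.1.1 i)) + altForm (x.1.1 (y.1.1 j))) *
      (x.2.1 * y.2.1) = _
    rw [← hy i j, ← h, Matrix.transpose_mul]
    simp only [Matrix.mul_assoc]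
  inv_mem' {x} hx i j := by
    have h := hx (x.1.1⁻¹ i) (x.1.1⁻¹ j)
    have hx' : ∀ k, x.1.1 (x.1.1⁻¹ k) = k := fun k => x.1.1.apply_symm_apply k
    rw [hx', hx'] at h
    have h1 : x.2.1 * (x.2⁻¹).1 = 1 := x.2.mul_inv
    have h2 : (x.2⁻¹).1ᵀ * x.2.1ᵀ = 1 := by rw [← Matrix.transpose_mul, h1, Matrix.transpose_one]
    change (x.2⁻¹).1ᵀ * (altForm (x.1.1⁻¹ i) + altForm (x.1.1⁻¹ j)) * (x.2⁻¹).1 = _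
    rw [← h]
    calc _ = ((x.2⁻¹).1ᵀ * x.2.1ᵀ) * (altForm i + altForm j) * (x.2.1 * (x.2⁻¹).1) := by
          simp only [Matrix.mul_assoc]
      _ = _ := by rw [h1, h2, Matrix.one_mul, Matrix.mul_one]

/-- Matrices realizing generating three-cycles. -/
def genA₈ (i : Fin 6) : GL (Fin 4) (ZMod 2) where
  val := (![!![0, 1, 0, 0; 1, 1, 0, 0; 0, 0, 1, 1; 0, 0, 1, 0],
    !![1, 1, 1, 0; 1, 0, 0, 1; 0, 0, 0, 1; 0, 0, 1, 1],
    !![0, 1, 1, 0; 0, 1, 0, 1; 1, 0, 1, 1; 0, 1, 0, 0],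
    !![1, 0, 1, 0; 0, 0, 0, 1; 1, 0, 0, 0; 0, 1, 0, 1],
    !![0, 0, 1, 0; 1, 1, 0, 1; 1, 0, 1, 0; 0, 1, 1, 0],
    !![1, 1, 0, 0; 1, 0, 0, 0; 1, 0, 0, 1; 0, 1, 1, 1]] :
    Fin 6 → Matrix (Fin 4) (Fin 4) (ZMod 2)) i
  inv := (![!![1, 1, 0, 0; 1, 0, 0, 0; 0, 0, 0, 1; 0, 0, 1, 1],
    !![0, 1, 1, 0; 1, 1, 0, 1; 0, 0, 1, 1; 0, 0, 1, 0],
    !![1, 1, 1, 0; 0, 0, 0, 1; 1, 0, 0, 1; 0, 1, 0, 1],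
    !![0, 0, 1, 0; 0, 1, 0, 1; 1, 0, 1, 0; 0, 1, 0, 0],
    !![1, 0, 1, 0; 1, 0, 0, 1; 1, 0, 0, 0; 0, 1, 1, 1],
    !![0, 1, 0, 0; 1, 1, 0, 0; 1, 0, 1, 1; 0, 1, 1, 0]] :
    Fin 6 → Matrix (Fin 4) (Fin 4) (ZMod 2)) i
  val_inv := by revert i; decide +kernel
  inv_val := by revert i; decide +kernel

theorem genA₈_mem (i : Fin 6) :
    (swapMulSwap i.succ.succ (Fin.succ_ne_zero _), genA₈ i) ∈ graphA₈ := by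
  change ∀ j k, (genA₈ i).1ᵀ * (altForm (swap 0 1 (swap 0 (i.succ.succ) j)) +
    altForm (swap 0 1 (swap 0 (i.succ.succ) k))) * (genA₈ i).1 = altForm j + altForm k
  revert i
  decide +kernel

/-- The eight forms span all alternating forms, so the hypothesis says that `x ∧ y` equals `e_a ∧
e_b`; hence `x` is a nonzero vector of the plane spanned by `e_a` and `e_b`. Varying `b` confines
column `a` of a matrix preserving the forms to the line of `e_a`. -/
theorem eq_single_of_altForm_eq : ∀ a b : Fin 4, a ≠ b → ∀ x y : Fin 4 → ZMod 2,
    (∀ i, x ⬝ᵥ (altForm i *ᵥ y) = altForm i a b) → ∀ c, c ≠ a → c ≠ b → x c = 0 ∧ x ≠ 0 := by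
  decide +kernel

theorem exists_hom_A₈ : ∃ f : alternatingGroup (Fin 8) →* GL (Fin 4) (ZMod 2),
    ∀ i : Fin 6, f (swapMulSwap i.succ.succ (Fin.succ_ne_zero _)) = genA₈ i := by
  obtain ⟨f, hf⟩ := exists_hom_of_graph (a := (0 : Fin 8)) (b := 1) (by simp) graphA₈ (by
    intro M hM
    have h0 : altForm 0 = 0 := by decide +kernel
    have hM' : ∀ i, M.1ᵀ * altForm i * M.1 = altForm i := fun i => by
      have := hM i 0
      change M.1ᵀ * (altForm i + altForm 0) * M.1 = _ at this
      rwa [h0, add_zero] at this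
    have hcol : ∀ a b : Fin 4, a ≠ b → ∀ c, c ≠ a → c ≠ b → M.1 c a = 0 ∧
        (fun k => M.1 k a) ≠ 0 := by
      intro a b hab
      refine eq_single_of_altForm_eq a b hab (fun k => M.1 k a) (fun k => M.1 k b) fun i => ?_
      have := congr($(hM' i) a b)
      rwa [Matrix.mul_assoc] at this
    have hb : ∀ a c : Fin 4, ∃ b, a ≠ b ∧ c ≠ b := by decide
    have hc : ∀ a : Fin 4, ∃ c, c ≠ a := by decide
    ext c a
    rw [Units.val_one, Matrix.one_apply]
    split_ifs with h
    · subst h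
      have hne : ∀ t : ZMod 2, t ≠ 0 → t = 1 := by decide
      refine hne _ fun h0 => ?_
      obtain ⟨d, hd⟩ := hc c
      obtain ⟨b, hb₁, hb₂⟩ := hb c d
      refine (hcol c b hb₁ d hd hb₂).2 (funext fun k => ?_)
      rcases eq_or_ne k c with rfl | hk
      · exact h0
      · obtain ⟨b, hb₁, hb₂⟩ := hb c k
        exact (hcol c b hb₁ k hk hb₂).1
    · obtain ⟨b, hb₁, hb₂⟩ := hb a c
      exact (hcol a b hb₁ c h hb₂).1) (by
    intro i hi hi'
    obtain ⟨i, rfl⟩ := Fin.exists_succ_eq.2 hi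
    obtain ⟨i, rfl⟩ := Fin.exists_succ_eq.2 (fun h : i = 0 => hi' (by simp [h]))
    exact ⟨_, genA₈_mem i, rfl⟩)
  exact ⟨f, fun i => hf _ _ (genA₈_mem i)⟩

end FourDimensional

section Representations

variable {G K : Type*} [Group G] [Field K] {n : ℕ}

/-- The representation on column vectors defined by a homomorphism to a general linear group. -/
def matrixRep (f : G →* GL (Fin n) K) : Representation K G (Fin n → K) :=
  (Matrix.toLinAlgEquiv' : Matrix (Fin n) (Fin n) K ≃ₐ[K] _).toMonoidHom.comp
    ((Units.coeHom _).comp f)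

theorem matrixRep_apply (f : G →* GL (Fin n) K) (g : G) (v : Fin n → K) :
    matrixRep f g v = (f g).1 *ᵥ v := rfl

end Representations

theorem edExt_A₈_le {K L : Type*} [Field K] [Field L] [Algebra K L] [CharP K 2]
    {Φ : alternatingGroup (Fin 8) →* (L ≃ₐ[K] L)} (hΦ : Function.Injective Φ) :
    edExt (IntermediateField.fixedField Φ.range) ≤ 3 := by
  obtain ⟨f, hf⟩ := exists_hom_A₈
  have : IsSimpleGroup (alternatingGroup (Fin 8)) := alternatingGroup.isSimpleGroup (by simp)
  let F := (Matrix.GeneralLinearGroup.map (ZMod.castHom (dvd_refl 2) K)).comp f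
  let t : Fin 6 → alternatingGroup (Fin 8) := fun i =>
    swapMulSwap i.succ.succ (Fin.succ_ne_zero _)
  have hF : ∀ i, (F (t i)).1 = (genA₈ i).1.map (ZMod.castHom (dvd_refl 2) K) := fun i => by
    change ((f (t i)).1).map _ = _
    rw [hf]
  have h0 : (F (t 0)).1 = !![0, 1, 0, 0; 1, 1, 0, 0; 0, 0, 1, 1; 0, 0, 1, 0] := by
    rw [hF]
    ext i j
    fin_cases i <;> fin_cases j <;> simp [genA₈]
  have h2 : (F (t 2)).1 = !![0, 1, 1, 0; 0, 1, 0, 1; 1, 0, 1, 1; 0, 1, 0, 0] := by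
    rw [hF]
    ext i j
    fin_cases i <;> fin_cases j <;> simp [genA₈]
  have h01 : (F (t 0 * t 1)).1 = !![1, 0, 0, 1; 0, 1, 1, 1; 0, 0, 1, 0; 0, 0, 0, 1] := by
    have hmul : (genA₈ 0).1 * (genA₈ 1).1 =
        !![1, 0, 0, 1; 0, 1, 1, 1; 0, 0, 1, 0; 0, 0, 0, 1] := by decide +kernel
    rw [map_mul, Units.val_mul, hF, hF, ← Matrix.map_mul, hmul]
    ext i j
    fin_cases i <;> fin_cases j <;> simp
  -- The first rows of the matrices of `1`, `t 0`, `t 2` and `t 0 * t 1` are independent, so the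
  -- orbit of the first coordinate separates points. The product `t 0 * t 1` is a unipotent
  -- involution fixing the first basis vector.
  have key := edExt_le_of_representation (n := 3) hΦ (matrixRep F) (LinearMap.proj 0)
    (fun v hv => ?_) (g₁ := t 0 * t 1) (v₁ := ![1, 0, 0, 0]) (fun h => ?_) (fun h => ?_) ?_
  · exact_mod_cast key
  · have e0 := hv 1
    have e1 := hv (t 0)
    have e2 := hv (t 2)
    have e3 := hv (t 0 * t 1)
    rw [map_one] at e0
    simp only [LinearMap.proj_apply, matrixRep_apply, h0, h2, h01] at e1 e2 e3
    simp [Matrix.mulVec, dotProduct, Fin.sum_univ_four] at e0 e1 e2 e3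
    simp [e0, e1] at e2 e3
    ext i
    fin_cases i
    exacts [e0, e1, e2, e3]
  · have := congr($h ![0, 0, 1, 0] 1)
    rw [matrixRep_apply, h01] at this
    simp [Matrix.mulVec, dotProduct, Fin.sum_univ_four] at this
  · simpa using congr($h 0)
  · rw [matrixRep_apply, h01]
    ext i
    fin_cases i <;> simp [Matrix.mulVec, dotProduct, Fin.sum_univ_four]

/-! ### `A₅` and `SL₂(𝔽₄)`. -/

section TwoDimensional

variable {K : Type*} [Field K]

/-- Representatives of the five points of the projective line over `𝔽₄`. -/
def projPoint (ω : K) : Fin 5 → Fin 2 → K :=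
  ![![1, 0], ![0, 1], ![1, 1], ![1, ω], ![1, ω ^ 2]]

/-- The graph of the exceptional isomorphism of `A₅` with `SL₂(𝔽₄)`. -/
def graphA₅ (ω : K) : Subgroup (alternatingGroup (Fin 5) × GL (Fin 2) K) where
  carrier := {x | x.2.1.det = 1 ∧
    ∀ i, ∃ c : K, c ≠ 0 ∧ x.2.1 *ᵥ projPoint ω i = c • projPoint ω (x.1.1 i)}
  one_mem' := ⟨Matrix.det_one, fun i => ⟨1, one_ne_zero, by simp⟩⟩
  mul_mem' {x y} hx hy := by
    refine ⟨?_, fun i => ?_⟩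
    · change (x.2.1 * y.2.1).det = 1
      rw [Matrix.det_mul, hx.1, hy.1, one_mul]
    · obtain ⟨c, hc, hyc⟩ := hy.2 i
      obtain ⟨d, hd, hxd⟩ := hx.2 (y.1.1 i)
      refine ⟨c * d, mul_ne_zero hc hd, ?_⟩
      change (x.2.1 * y.2.1) *ᵥ _ = (c * d) • projPoint ω (x.1.1 (y.1.1 i))
      rw [← Matrix.mulVec_mulVec, hyc, Matrix.mulVec_smul, hxd, smul_smul]
  inv_mem' {x} hx := by
    have h1 : (x.2⁻¹).1 * x.2.1 = 1 := x.2.inv_mul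
    refine ⟨?_, fun i => ?_⟩
    · have := congr(($h1).det)
      rwa [Matrix.det_mul, hx.1, mul_one, Matrix.det_one] at this
    · obtain ⟨c, hc, h⟩ := hx.2 (x.1.1⁻¹ i)
      rw [show x.1.1 (x.1.1⁻¹ i) = i from x.1.1.apply_symm_apply i] at h
      refine ⟨c⁻¹, inv_ne_zero hc, ?_⟩
      change (x.2⁻¹).1 *ᵥ projPoint ω i = c⁻¹ • projPoint ω (x.1.1⁻¹ i)
      rw [eq_inv_smul_iff₀ hc, ← Matrix.mulVec_smul, ← h, Matrix.mulVec_mulVec, h1,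
        Matrix.one_mulVec]

/-- The matrix permuting cyclically the points `0`, `[1 : y]` and `∞` of the projective line. -/
def genA₅ [CharP K 2] (y y' : K) (h : y * y' = 1) : GL (Fin 2) K where
  val := !![1, y'; y, 0]
  inv := !![0, y'; y, 1]
  val_inv := by
    have h2 : (2 : K) = 0 := CharTwo.two_eq_zero
    ext i j
    fin_cases i <;> fin_cases j <;> simp [Matrix.mul_apply, Fin.sum_univ_two] <;> grind
  inv_val := by
    have h2 : (2 : K) = 0 := CharTwo.two_eq_zero
    ext i j
    fin_cases i <;> fin_cases j <;> simp [Matrix.mul_apply, Fin.sum_univ_two] <;> grind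

theorem genA₅_mem [CharP K 2] {ω : K} (hω : ω ^ 2 + ω + 1 = 0) (i : Fin 5) (hi : i ≠ 0)
    {y y' : K} (h : y * y' = 1) (hy : projPoint ω i = ![1, y]) :
    (swapMulSwap i hi, genA₅ y y' h) ∈ graphA₅ ω := by
  have h2 : (2 : K) = 0 := CharTwo.two_eq_zero
  have hy0 : y ≠ 0 := left_ne_zero_of_mul_eq_one h
  have hmul : ∀ a b : K, (genA₅ y y' h).1 *ᵥ ![a, b] = ![a + y' * b, y * a] := fun a b => by
    ext j
    fin_cases j <;> simp [genA₅, Matrix.mulVec, dotProduct, Fin.sum_univ_two]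
  refine ⟨?_, fun k => ?_⟩
  · change Matrix.det !![1, y'; y, 0] = 1
    rw [Matrix.det_fin_two_of]
    grind
  change ∃ c : K, c ≠ 0 ∧ (genA₅ y y' h).1 *ᵥ projPoint ω k =
    c • projPoint ω (swap 0 1 (swap 0 i k))
  have hzero : (genA₅ y y' h).1 *ᵥ projPoint ω 0 = (1 : K) • projPoint ω i := by
    rw [hy]
    change _ *ᵥ ![1, 0] = _
    rw [hmul]
    simp
  have hinf : (genA₅ y y' h).1 *ᵥ projPoint ω 1 = y' • projPoint ω 0 := by
    change _ *ᵥ ![0, 1] = y' • ![1, 0]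
    rw [hmul]
    simp
  have hmid : (genA₅ y y' h).1 *ᵥ projPoint ω i = y • projPoint ω 1 := by
    rw [hy]
    change _ = y • ![0, 1]
    rw [hmul]
    ext j
    fin_cases j <;> simp
    grind
  -- The quadratic condition says that `z / y` is a primitive cube root of unity; then `[1 : z]` is
  -- an eigenline with eigenvalue `1 + y' * z`.
  have hfix : ∀ k z, projPoint ω k = ![1, z] → y + z ≠ 0 → y ^ 2 + y * z + z ^ 2 = 0 →
      ∃ c : K, c ≠ 0 ∧ (genA₅ y y' h).1 *ᵥ projPoint ω k = c • projPoint ω k := by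
    intro k z hk hyz hq
    refine ⟨1 + y' * z, fun hc => hyz (by linear_combination y * hc - z * h), ?_⟩
    rw [hk, hmul]
    ext j
    fin_cases j <;> simp
    grind
  have hω0 : ω ≠ 0 := by rintro rfl; simp at hω
  have hω1 : 1 + ω ≠ 0 := fun h' => hω0 (pow_eq_zero_iff two_ne_zero |>.1
    (by linear_combination hω - h'))
  have hω2 : 1 + ω ^ 2 ≠ 0 := fun h' => hω0 (by linear_combination hω - h')
  have hω3 : ω + ω ^ 2 ≠ 0 := fun h' => one_ne_zero (α := K) (by linear_combination hω - h')
  have hy' : y' ≠ 0 := right_ne_zero_of_mul_eq_one h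
  have hy1 := congr($hy 1)
  fin_cases i
  · exact absurd rfl hi
  · simpa [projPoint] using congr($hy 0)
  · obtain rfl : 1 = y := hy1
    fin_cases k
    · exact ⟨_, one_ne_zero, hzero⟩
    · exact ⟨_, hy', hinf⟩
    · exact ⟨_, hy0, hmid⟩
    · exact hfix 3 ω rfl hω1 (by linear_combination hω)
    · exact hfix 4 (ω ^ 2) rfl hω2 (by linear_combination (ω ^ 2 - ω + 1) * hω)
  · obtain rfl : ω = y := hy1
    fin_cases k
    · exact ⟨_, one_ne_zero, hzero⟩
    · exact ⟨_, hy', hinf⟩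
    · exact hfix 2 1 rfl (by rwa [add_comm]) (by linear_combination hω)
    · exact ⟨_, hy0, hmid⟩
    · exact hfix 4 (ω ^ 2) rfl hω3 (by linear_combination ω ^ 2 * hω)
  · obtain rfl : ω ^ 2 = y := hy1
    fin_cases k
    · exact ⟨_, one_ne_zero, hzero⟩
    · exact ⟨_, hy', hinf⟩
    · exact hfix 2 1 rfl (by rwa [add_comm]) (by linear_combination (ω ^ 2 - ω + 1) * hω)
    · exact hfix 3 ω rfl (by rwa [add_comm]) (by linear_combination ω ^ 2 * hω)
    · exact ⟨_, hy0, hmid⟩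

theorem exists_hom_A₅ [CharP K 2] {ω : K} (hω : ω ^ 2 + ω + 1 = 0) (h : ω * ω ^ 2 = 1) :
    ∃ f : alternatingGroup (Fin 5) →* GL (Fin 2) K,
      f (swapMulSwap 2 (by simp)) = genA₅ 1 1 (mul_one 1) ∧
      f (swapMulSwap 3 (by simp)) = genA₅ ω (ω ^ 2) h := by
  have h2 : (2 : K) = 0 := CharTwo.two_eq_zero
  have m2 := genA₅_mem hω 2 (by simp) (mul_one (1 : K)) rfl
  have m3 := genA₅_mem hω 3 (by simp) h rfl
  have m4 := genA₅_mem hω 4 (by simp) ((mul_comm _ _).trans h) rfl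
  obtain ⟨f, hf⟩ := exists_hom_of_graph (a := (0 : Fin 5)) (b := 1) (by simp) (graphA₅ ω) (by
    rintro M ⟨hdet, hM⟩
    obtain ⟨c, -, hc⟩ := hM 0
    obtain ⟨d, -, hd⟩ := hM 1
    obtain ⟨e, -, he⟩ := hM 2
    have c0 := congr($hc 0)
    have c1 := congr($hc 1)
    have d0 := congr($hd 0)
    have d1 := congr($hd 1)
    have e0 := congr($he 0)
    have e1 := congr($he 1)
    simp [projPoint, Matrix.mulVec, dotProduct, Fin.sum_univ_two] at c0 c1 d0 d1 e0 e1
    rw [Matrix.det_fin_two] at hdet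
    -- A matrix fixing three points of the projective line is scalar, and a scalar of square 1 is 1
    -- in characteristic 2.
    have h1 : M.1 0 0 = 1 := by
      have : (M.1 0 0 - 1) ^ 2 = 0 := by grind
      exact sub_eq_zero.1 (pow_eq_zero_iff two_ne_zero |>.1 this)
    ext i j
    fin_cases i <;> fin_cases j <;> simp <;> grind) (by
    intro i hi hi'
    fin_cases i
    · exact absurd rfl hi
    · exact absurd rfl hi'
    · exact ⟨_, m2, rfl⟩
    · exact ⟨_, m3, rfl⟩
    · exact ⟨_, m4, rfl⟩)
  exact ⟨f, hf _ _ m2, hf _ _ m3⟩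

theorem edExt_A₅_le {L : Type*} [Field L] [Algebra K L] [CharP K 2] {ω : K}
    (hω : ω ^ 2 + ω + 1 = 0) {Φ : alternatingGroup (Fin 5) →* (L ≃ₐ[K] L)}
    (hΦ : Function.Injective Φ) : edExt (IntermediateField.fixedField Φ.range) ≤ 1 := by
  have h2 : (2 : K) = 0 := CharTwo.two_eq_zero
  have hω3 : ω * ω ^ 2 = 1 := by linear_combination (ω - 1) * hω
  obtain ⟨f, hf2, hf3⟩ := exists_hom_A₅ hω hω3
  let s := swapMulSwap (2 : Fin 5) (by simp)
  let t := swapMulSwap (3 : Fin 5) (by simp)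
  have hs : (f s).1 = !![1, 1; 1, 0] := by rw [hf2]; rfl
  have hst : (f (s * t)).1 = !![ω ^ 2, ω ^ 2; 1, ω ^ 2] := by
    rw [map_mul, hf2, hf3, Units.val_mul]
    ext i j
    fin_cases i <;> fin_cases j <;> simp [genA₅, Matrix.mul_apply, Fin.sum_univ_two]
    all_goals grind
  -- The first rows for `1` and `s` are independent. The matrix of `s * t` has trace 0 and
  -- determinant 1, so it is unipotent; `![ω, 1]` spans its fixed line.
  have key := edExt_le_of_representation (n := 1) hΦ (matrixRep f) (LinearMap.proj 0)
    (fun v hv => ?_) (g₁ := s * t) (v₁ := ![ω, 1]) (fun h => ?_) (fun h => ?_) ?_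
  · exact_mod_cast key
  · have e0 := hv 1
    have e1 := hv s
    rw [map_one] at e0
    simp only [LinearMap.proj_apply, matrixRep_apply, hs] at e1
    simp [Matrix.mulVec, dotProduct, Fin.sum_univ_two] at e0 e1
    simp [e0] at e1
    ext i
    fin_cases i
    exacts [e0, e1]
  · have := congr($h ![1, 0] 1)
    rw [matrixRep_apply, hst] at this
    simp [Matrix.mulVec, dotProduct, Fin.sum_univ_two] at this
  · simpa using congr($h 1)
  · rw [matrixRep_apply, hst]
    ext i
    fin_cases i <;> simp [Matrix.mulVec, dotProduct, Fin.sum_univ_two] <;> grind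

theorem exists_sq_add_self_add_one {F : Type*} [Field F] [Fintype F] (hF : Fintype.card F = 4) :
    ∃ x : F, x ^ 2 + x + 1 = 0 := by
  classical
  obtain ⟨x, -, hx⟩ : ∃ x ∈ (Finset.univ : Finset F), x ∉ ({0, 1} : Finset F) :=
    Finset.exists_mem_notMem_of_card_lt_card
      (Finset.card_le_two.trans_lt (by rw [Finset.card_univ, hF]; norm_num))
  simp only [Finset.mem_insert, Finset.mem_singleton, not_or] at hx
  have h4 : x ^ 4 = x := by rw [← hF]; exact FiniteField.pow_card x
  have h0 : (x * (x - 1)) * (x ^ 2 + x + 1) = 0 := by linear_combination h4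
  exact ⟨x, (mul_eq_zero.1 h0).resolve_left (mul_ne_zero hx.1 (sub_ne_zero.2 hx.2))⟩

theorem charP_two_and_exists_of_galoisField (σ : GaloisField 2 2 →+* K) :
    CharP K 2 ∧ ∃ ω : K, ω ^ 2 + ω + 1 = 0 := by
  refine ⟨charP_of_injective_ringHom σ.injective 2, ?_⟩
  have := Fintype.ofFinite (GaloisField 2 2)
  obtain ⟨x, hx⟩ := exists_sq_add_self_add_one (F := GaloisField 2 2)
    (by rw [Fintype.card_eq_nat_card, GaloisField.card 2 2 two_ne_zero]; norm_num)
  exact ⟨σ x, by rw [← map_pow, ← map_add, ← map_one σ, ← map_add, hx, map_zero]⟩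

end TwoDimensional

theorem edRep_A₈_le {K V : Type*} [Field K] [CharP K 2] [AddCommGroup V] [Module K V]
    {ρ : Representation K (alternatingGroup (Fin 8)) V} (hρ : Function.Injective ρ) :
    edRep ρ ≤ 3 :=
  edExt_A₈_le (funFieldAut_injective hρ)

theorem edRep_A₅_eq {K V : Type*} [Field K] [CharP K 2] {ω : K} (hω : ω ^ 2 + ω + 1 = 0)
    [AddCommGroup V] [Module K V] {ρ : Representation K (alternatingGroup (Fin 5)) V}
    (hρ : Function.Injective ρ) : edRep ρ = 1 :=
  have hle : edRep ρ ≤ 1 := edExt_A₅_le hω (funFieldAut_injective hρ)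
  hle.antisymm (one_le_edRep hρ)

end EssDim

theorem lemma5p5 (K : Type*) [Field K] :
    (CharP K 2 →
      ∀ (V : Type*) [AddCommGroup V] [Module K V] [FiniteDimensional K V]
        (ρ : Representation K (alternatingGroup (Fin 8)) V), Function.Injective ρ →
        EssDim.edRep ρ ≤ 3) ∧
    (Nonempty (GaloisField 2 2 →+* K) →
      ∀ (V : Type*) [AddCommGroup V] [Module K V] [FiniteDimensional K V]
        (ρ : Representation K (alternatingGroup (Fin 5)) V), Function.Injective ρ →
        EssDim.edRep ρ = 1) := by
  refine ⟨fun _ V _ _ _ ρ hρ => EssDim.edRep_A₈_le hρ, ?_⟩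
  rintro ⟨σ⟩ V _ _ _ ρ hρ
  obtain ⟨_, ω, hω⟩ := EssDim.charP_two_and_exists_of_galoisField σ
  exact EssDim.edRep_A₅_eq hω hρ
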